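/- Let $k$ be a field and let $M$ be a finite monoid, with Green's relations $x\mathcal{L}y \Leftrightarrow Mx=My$, $x\mathcal{R}y \Leftrightarrow xM=yM$, $\mathcal{H}=\mathcal{L}\cap\mathcal{R}$, and $x\mathcal{D}y$ if and only if $x\mathcal{L}z$ and $z\mathcal{R}y$ for some $z\in M$. For every $\mathcal{D}$-class $D$ choose an element $\gamma_D\in D$, let $H$ be the $\mathcal{H}$-class of $\gamma_D$, and let $G_D=\{r_m : m\in M,\ Hm\subseteq H\}$, where $r_m:H\to H$ is the right translation $h\mapsto hm$, with product $r_mr_n=r_{mn}$. This is a group, the Schützenberger group of $D$; up to isomorphism it does not depend on $\gamma_D$. A $k$-algebra $A$ (associative, with unit) is called a cell algebra if there are a finite partially ordered set $\Lambda$, finite sets $L(\lambda)$ and $R(\lambda)$ for $\lambda\in\Lambda$, and a $k$-basis $({}_sC_t^\lambda)_{\lambda\in\Lambda,\,s\in L(\lambda),\,t\in R(\lambda)}$ of $A$ such that, with $\hat A^\lambda$ the $k$-span of all ${}_sC_t^\mu$ with $\mu>\lambda$, $s\in L(\mu)$, $t\in R(\mu)$: (i) for all $a\in A$, $\lambda\in\Lambda$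 and $s\in L(\lambda)$ there are $r_{s'}\in k$ ($s'\in L(\lambda)$) such that $a\cdot{}_sC_t^\lambda\equiv\sum_{s'\in L(\lambda)}r_{s'}\,{}_{s'}C_t^\lambda \pmod{\hat A^\lambda}$ for all $t\in R(\lambda)$; (ii) for all $a\in A$, $\lambda\in\Lambda$ and $t\in R(\lambda)$ there are $r_{t'}\in k$ ($t'\in R(\lambda)$) such that ${}_sC_t^\lambda\cdot a\equiv\sum_{t'\in R(\lambda)}r_{t'}\,{}_sC_{t'}^\lambda \pmod{\hat A^\lambda}$ for all $s\in L(\lambda)$. An $\mathcal{L}$-class $L\subseteq D$ and an $\mathcal{R}$-class $R\subseteq D$ are called matched if $xy\in D$ for some $x\in L$ and $y\in R$, and unmatched otherwise. Suppose that for every $\mathcal{D}$-class $D$ of $M$: 1. the group algebra $k[G_D]$ is a semisimple cell algebra, and 2. (bijection condition) there is a bijection $F$ from the set of $\mathcal{L}$-classes contained in $D$ to the set of $\mathcal{R}$-classes contained in $D$ such that $L$ and $F(L)$ are matched for every $L$, while $L$ and $R$ are unmatched whenever $R\neq F(L)$. Then the monoid algebra $k[M]$ is a semisimple cell algebra. 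-/

import Mathlib

/-! ### Green's relations -/

/-- `x 𝓛 y` when `Mx = My`. -/
def GreenL {M : Type*} [Monoid M] (x y : M) : Prop :=
  Set.range (fun m : M => m * x) = Set.range (fun m : M => m * y)

/-- `x 𝓡 y` when `xM = yM`. -/
def GreenR {M : Type*} [Monoid M] (x y : M) : Prop :=
  Set.range (fun m : M => x * m) = Set.range (fun m : M => y * m)

/-- `x 𝓗 y` when `x 𝓛 y` and `x 𝓡 y`. -/
def GreenH {M : Type*} [Monoid M] (x y : M) : Prop :=
  GreenL x y ∧ GreenR x y

/-- `x 𝓓 y` when `x 𝓛 z` and `z 𝓡 y` for some `z`. -/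
def GreenD {M : Type*} [Monoid M] (x y : M) : Prop :=
  ∃ z : M, GreenL x z ∧ GreenR z y

/-- The `𝓗`-class of `x`. -/
def HClass {M : Type*} [Monoid M] (x : M) : Set M := {y | GreenH x y}

/-- The set of all `𝓓`-classes of `M`, each of them a subset of `M`. -/
def DClass (M : Type*) [Monoid M] : Type _ :=
  {D : Set M // ∃ x : M, D = {y | GreenD x y}}

/-- The `𝓛`-classes of `M` contained in the subset `D`. -/
def LClassesIn {M : Type*} [Monoid M] (D : Set M) : Type _ :=
  {L : Set M // (∃ x : M, L = {y | GreenL x y}) ∧ L ⊆ D}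

/-- The `𝓡`-classes of `M` contained in the subset `D`. -/
def RClassesIn {M : Type*} [Monoid M] (D : Set M) : Type _ :=
  {R : Set M // (∃ x : M, R = {y | GreenR x y}) ∧ R ⊆ D}

/-- `L` and `R` are matched (relative to `D`) when `xy ∈ D` for some `x ∈ L` and `y ∈ R`. -/
def Matched {M : Type*} [Monoid M] (D L R : Set M) : Prop :=
  ∃ x ∈ L, ∃ y ∈ R, x * y ∈ D

/-- The bijection condition: some bijection `F` from the `𝓛`-classes in `D` to the `𝓡`-classes
in `D` is such that `L` and `F L` are matched, and `L` and `R` are not matched if `R ≠ F L`. -/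
def BijectionCondition {M : Type*} [Monoid M] (D : Set M) : Prop :=
  ∃ F : LClassesIn D ≃ RClassesIn D,
    (∀ L : LClassesIn D, Matched D L.1 (F L).1) ∧
    (∀ (L : LClassesIn D) (R : RClassesIn D), R ≠ F L → ¬ Matched D L.1 R.1)

/-! ### The Schützenberger group -/

/-- `RT(H) = {m ∈ M : Hm ⊆ H}`. -/
def RT {M : Type*} [Monoid M] (H : Set M) : Submonoid M where
  carrier := {m | ∀ h ∈ H, h * m ∈ H}
  one_mem' := fun h hh => by simpa using hh
  mul_mem' := fun {a b} ha hb h hh => by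
    rw [← mul_assoc]
    exact hb _ (ha _ hh)

/-- `m ↦ r_m`, where `r_m : H → H` is the right translation `h ↦ hm`. Since translations act
on the right, their product `r_m r_n` means "first `r_m`, then `r_n`", so that
`r_m r_n = r_{mn}`; this is the reason for the opposite monoid. -/
def rightTranslation {M : Type*} [Monoid M] (H : Set M) :
    RT H →* (Function.End H)ᵐᵒᵖ where
  toFun m := MulOpposite.op (fun h : H => (⟨(h : M) * (m : M), m.2 h h.2⟩ : H))
  map_one' := by
    apply MulOpposite.unop_injective
    funext h
    exact Subtype.ext (mul_one (h : M))
  map_mul' m n := by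
    apply MulOpposite.unop_injective
    funext h
    exact Subtype.ext (mul_assoc (h : M) (m : M) (n : M)).symm

/-- The (right) Schützenberger group `{r_m : m ∈ RT(H)}` of `H`. For an `𝓗`-class `H` it is a
group, see `isUnit_schutzenbergerGroup`. -/
def SchutzenbergerGroup {M : Type*} [Monoid M] (H : Set M) :
    Submonoid (Function.End H)ᵐᵒᵖ :=
  MonoidHom.mrange (rightTranslation H)

theorem greenL_iff {M : Type*} [Monoid M] (x y : M) :
    GreenL x y ↔ (∃ u, u * y = x) ∧ (∃ v, v * x = y) := by
  constructor
  · intro h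
    have h1 : x ∈ Set.range (fun m : M => m * y) := h ▸ ⟨1, one_mul x⟩
    have h2 : y ∈ Set.range (fun m : M => m * x) := h.symm ▸ ⟨1, one_mul y⟩
    exact ⟨h1, h2⟩
  · rintro ⟨⟨u, hu⟩, ⟨v, hv⟩⟩
    ext z
    constructor
    · rintro ⟨m, rfl⟩
      exact ⟨m * u, by simp [mul_assoc, hu]⟩
    · rintro ⟨m, rfl⟩
      exact ⟨m * v, by simp [mul_assoc, hv]⟩

theorem greenR_iff {M : Type*} [Monoid M] (x y : M) :
    GreenR x y ↔ (∃ u, y * u = x) ∧ (∃ v, x * v = y) := by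
  constructor
  · intro h
    have h1 : x ∈ Set.range (fun m : M => y * m) := h ▸ ⟨1, mul_one x⟩
    have h2 : y ∈ Set.range (fun m : M => x * m) := h.symm ▸ ⟨1, mul_one y⟩
    exact ⟨h1, h2⟩
  · rintro ⟨⟨u, hu⟩, ⟨v, hv⟩⟩
    ext z
    constructor
    · rintro ⟨m, rfl⟩
      exact ⟨u * m, by simp [← mul_assoc, hu]⟩
    · rintro ⟨m, rfl⟩
      exact ⟨v * m, by simp [← mul_assoc, hv]⟩

/-- The Schützenberger group of an `𝓗`-class is a group. -/
theorem isUnit_schutzenbergerGroup {M : Type*} [Monoid M] (γ : M)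
    (g : SchutzenbergerGroup (HClass γ)) : IsUnit g := by
  obtain ⟨_, ⟨m, rfl⟩⟩ := g
  have hγ : γ ∈ HClass γ := ⟨rfl, rfl⟩
  have hm : γ * (m : M) ∈ HClass γ := m.2 γ hγ
  obtain ⟨t, ht⟩ := ((greenR_iff _ _).1 hm.2).1
  have hmt : ∀ h ∈ HClass γ, h * (m : M) * t = h := by
    intro h hh
    obtain ⟨v, rfl⟩ := ((greenL_iff _ _).1 hh.1).2
    rw [mul_assoc v, mul_assoc v, ht]
  have key : ∀ h ∈ HClass γ, h * t ∈ HClass γ ∧ h * t * (m : M) = h := by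
    intro h hh
    obtain ⟨⟨a, ha⟩, ⟨b, hb⟩⟩ := (greenL_iff _ _).1 (hm.1.symm.trans hh.1)
    have e1 : h * t = b * γ := by rw [← hb, mul_assoc b, ht]
    have e2 : h * t * (m : M) = h := by rw [e1, mul_assoc, hb]
    refine ⟨⟨(greenL_iff _ _).2 ⟨⟨a, ?_⟩, ⟨b, e1.symm⟩⟩, ?_⟩, e2⟩
    · rw [← mul_assoc, ha, ht]
    · exact hh.2.trans ((greenR_iff _ _).2 ⟨⟨m, e2⟩, ⟨t, rfl⟩⟩)
  let t' : RT (HClass γ) := ⟨t, fun h hh => (key h hh).1⟩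
  refine ⟨⟨⟨_, m, rfl⟩, ⟨_, t', rfl⟩, ?_, ?_⟩, rfl⟩
  · apply Subtype.ext
    apply MulOpposite.unop_injective
    funext h
    exact Subtype.ext (hmt h h.2)
  · apply Subtype.ext
    apply MulOpposite.unop_injective
    funext h
    exact Subtype.ext (key h h.2).2

/-! ### Cell algebras -/

/-- A cell algebra structure on the `R`-algebra `A`: a finite poset `Λ`, finite sets `Lft l` and
`Rgt l` of left and right indices for `l ∈ Λ`, and an `R`-basis `C ⟨l, (s, t)⟩ = ₛCₜˡ` of `A`
such that multiplication by `a ∈ A` on the left acts on the left index only (with coefficients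
that do not depend on the right index), and on the right on the right index only, in both cases
modulo the span of the basis elements that belong to strictly greater elements of `Λ`. -/
structure CellStructure.{u₁, u₂, u₃, u₄, u₅} (R : Type u₁) (A : Type u₂) [CommRing R] [Ring A] [Algebra R A] where
  Λ : Type u₃
  [order : PartialOrder Λ]
  [finite : Finite Λ]
  Lft : Λ → Type u₄
  Rgt : Λ → Type u₅
  [fintypeLft : ∀ l, Fintype (Lft l)]
  [fintypeRgt : ∀ l, Fintype (Rgt l)]
  C : Module.Basis (Σ l : Λ, Lft l × Rgt l) R A
  mul_left : ∀ (a : A) (l : Λ) (s : Lft l), ∃ r : Lft l → R, ∀ t : Rgt l,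
    a * C ⟨l, (s, t)⟩ - ∑ s' : Lft l, r s' • C ⟨l, (s', t)⟩ ∈
      Submodule.span R {x : A | ∃ (l' : Λ) (p : Lft l' × Rgt l'), l < l' ∧ x = C ⟨l', p⟩}
  mul_right : ∀ (a : A) (l : Λ) (t : Rgt l), ∃ r : Rgt l → R, ∀ s : Lft l,
    C ⟨l, (s, t)⟩ * a - ∑ t' : Rgt l, r t' • C ⟨l, (s, t')⟩ ∈
      Submodule.span R {x : A | ∃ (l' : Λ) (p : Lft l' × Rgt l'), l < l' ∧ x = C ⟨l', p⟩}

/-- `A` is a cell algebra over `R`: it has a cell algebra structure. All index sets are finite,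
so it is no restriction to take them in `Type`, see `CellStructure.isCellAlgebra`. -/
def IsCellAlgebra (R A : Type*) [CommRing R] [Ring A] [Algebra R A] : Prop :=
  Nonempty (CellStructure.{_, _, 0, 0, 0} R A)

/-- Index sets in arbitrary universes give the same notion of a cell algebra. -/
theorem CellStructure.isCellAlgebra {R A : Type*} [CommRing R] [Ring A] [Algebra R A]
    (S : CellStructure R A) : IsCellAlgebra R A := by
  obtain ⟨Λ, Lft, Rgt, C, hl, hr⟩ := S
  obtain ⟨n, ⟨e⟩⟩ := Finite.exists_equiv_fin Λ
  let po : PartialOrder (Fin n) := PartialOrder.lift e.symm e.symm.injective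
  let fL := fun i : Fin n => Fintype.equivFin (Lft (e.symm i))
  let fR := fun i : Fin n => Fintype.equivFin (Rgt (e.symm i))
  let E : (Σ i : Fin n, Fin (Fintype.card (Lft (e.symm i))) × Fin (Fintype.card (Rgt (e.symm i))))
      ≃ (Σ l : Λ, Lft l × Rgt l) :=
    (Equiv.sigmaCongrRight fun i => ((fL i).symm.prodCongr (fR i).symm)).trans
      (Equiv.sigmaCongrLeft e.symm (β := fun l => Lft l × Rgt l))
  have hE : ∀ i p, E ⟨i, p⟩ = ⟨e.symm i, ((fL i).symm p.1, (fR i).symm p.2)⟩ :=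
    fun i p => rfl
  have hC : ∀ x, (C.reindex E.symm) x = C (E x) := fun x => by simp
  have hspan : ∀ i : Fin n,
      {x : A | ∃ (l' : Λ) (p : Lft l' × Rgt l'), e.symm i < l' ∧ x = C ⟨l', p⟩} ⊆
      {x : A | ∃ (l' : Fin n) (p : Fin (Fintype.card (Lft (e.symm l'))) ×
        Fin (Fintype.card (Rgt (e.symm l')))), po.lt i l' ∧ x = (C.reindex E.symm) ⟨l', p⟩} := by
    rintro i x ⟨l', p, hlt, rfl⟩
    obtain ⟨⟨j, q⟩, hj⟩ := E.surjective ⟨l', p⟩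
    have h1 : e.symm j = l' := congrArg Sigma.fst hj
    refine ⟨j, q, ?_, by rw [hC, hj]⟩
    rw [← h1] at hlt
    exact hlt
  refine ⟨@CellStructure.mk R A _ _ _ (Fin n) po _
    (fun i => Fin (Fintype.card (Lft (e.symm i))))
    (fun i => Fin (Fintype.card (Rgt (e.symm i)))) _ _ (C.reindex E.symm) ?_ ?_⟩
  · intro a i s
    obtain ⟨r, h⟩ := hl a (e.symm i) ((fL i).symm s)
    refine ⟨fun s' => r ((fL i).symm s'), fun t => ?_⟩
    simp only [hC, hE]
    have := h ((fR i).symm t)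
    rw [← Equiv.sum_comp (fL i).symm] at this
    simpa only [hC, hE] using Submodule.span_mono (hspan i) this
  · intro a i t
    obtain ⟨r, h⟩ := hr a (e.symm i) ((fR i).symm t)
    refine ⟨fun t' => r ((fR i).symm t'), fun s => ?_⟩
    simp only [hC, hE]
    have := h ((fL i).symm s)
    rw [← Equiv.sum_comp (fR i).symm] at this
    simpa only [hC, hE] using Submodule.span_mono (hspan i) this

/-! ### Green's relations in a finite monoid -/

section Green

variable {M : Type*} [Monoid M]

/-! The algebra `k[M]` is isomorphic to the product over all 𝓓-classes `D` of matrix algebras over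
`k[G_D]`, rows and columns indexed by the 𝓛-classes in `D`. Matrix algebras and finite products
preserve both cellularity and semisimplicity. Fix `γ ∈ D` and translations `r_i` carrying `γ` into
each 𝓛-class `i`. The 𝓡-class of `γ` then has coordinates `(g, j)`, and `m` acts by the matrix with
entry `g` at `(i, j)` when `γ r_i m` is the point `(g, j)`, and zero rows where the 𝓡-class is left.
The bijection condition says that for `m ∈ D` exactly one row is nonzero, and that `m ↦ (i, j, g)`
is a bijection from `D` to triples (`exists_eq_point`, `eq_of_eq_point`, `exists_mem_eq_point`,
`left_index_unique`). An `m` outside `D` acts nontrivially only if `D ⊆ MmM`. The map is thus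
triangular with respect to the two-sided ideals `MmM`, hence injective; counting triples gives
equality of dimensions. -/

theorem greenR_mul_left {x y : M} (h : GreenR x y) (a : M) : GreenR (a * x) (a * y) := by
  obtain ⟨⟨u, hu⟩, ⟨v, hv⟩⟩ := (greenR_iff _ _).1 h
  exact (greenR_iff _ _).2 ⟨⟨u, by rw [mul_assoc, hu]⟩, ⟨v, by rw [mul_assoc, hv]⟩⟩

theorem greenL_mul_right {x y : M} (h : GreenL x y) (a : M) : GreenL (x * a) (y * a) := by
  obtain ⟨⟨u, hu⟩, ⟨v, hv⟩⟩ := (greenL_iff _ _).1 h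
  exact (greenL_iff _ _).2 ⟨⟨u, by rw [← mul_assoc, hu]⟩, ⟨v, by rw [← mul_assoc, hv]⟩⟩

theorem greenD_of_greenL {x y : M} (h : GreenL x y) : GreenD x y := ⟨y, h, rfl⟩

theorem greenD_of_greenR {x y : M} (h : GreenR x y) : GreenD x y := ⟨x, rfl, h⟩

/-- 𝓛 and 𝓡 commute: if `x = uz` and `y = zv`, the other corner of the square is `uzv`. Symmetry and
transitivity of 𝓓 follow. -/
theorem greenD_iff_exists_greenR_greenL {x y : M} :
    GreenD x y ↔ ∃ z, GreenR x z ∧ GreenL z y := by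
  constructor
  · rintro ⟨z, hl, hr⟩
    obtain ⟨⟨u, rfl⟩, -⟩ := (greenL_iff _ _).1 hl
    obtain ⟨-, ⟨v, rfl⟩⟩ := (greenR_iff _ _).1 hr
    exact ⟨u * z * v, by simpa [mul_assoc] using greenR_mul_left hr u,
      greenL_mul_right hl v⟩
  · rintro ⟨z, hr, hl⟩
    obtain ⟨⟨u, rfl⟩, -⟩ := (greenR_iff _ _).1 hr
    obtain ⟨-, ⟨v, rfl⟩⟩ := (greenL_iff _ _).1 hl
    exact ⟨v * (z * u), by simpa [mul_assoc] using greenL_mul_right hl u,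
      by simpa [mul_assoc] using greenR_mul_left hr v⟩

theorem GreenD.symm {x y : M} (h : GreenD x y) : GreenD y x := by
  obtain ⟨z, hr, hl⟩ := greenD_iff_exists_greenR_greenL.1 h
  exact ⟨z, Eq.symm hl, Eq.symm hr⟩

theorem GreenD.trans {x y z : M} (h : GreenD x y) (h' : GreenD y z) : GreenD x z := by
  obtain ⟨a, h1, h2⟩ := h
  obtain ⟨b, h3, h4⟩ := greenD_iff_exists_greenR_greenL.1 h'
  obtain ⟨c, h5, h6⟩ := greenD_iff_exists_greenR_greenL.2 ⟨b, Eq.trans h2 h3, h4⟩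
  exact ⟨c, Eq.trans h1 h5, h6⟩

theorem GreenD.exists_eq_mul_mul {x y : M} (h : GreenD x y) : ∃ a b, x = a * y * b := by
  obtain ⟨z, hl, hr⟩ := h
  obtain ⟨⟨u, rfl⟩, -⟩ := (greenL_iff _ _).1 hl
  obtain ⟨⟨v, rfl⟩, -⟩ := (greenR_iff _ _).1 hr
  exact ⟨u, v, by simp [mul_assoc]⟩

theorem DClass.eq_setOf (D : DClass M) {γ : M} (hγ : γ ∈ D.1) : D.1 = {y | GreenD γ y} := by
  obtain ⟨x, hx⟩ := D.2
  rw [hx] at hγ ⊢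
  ext y
  exact ⟨fun h => (GreenD.symm hγ).trans h, fun h => GreenD.trans hγ h⟩

variable [Finite M]

/-- Stability of finite monoids: `xyM ⊆ xM`, while left translation by `a` maps `xyM` onto a set
containing `xM`, so the sizes agree. -/
theorem greenR_mul_of_eq {x y a b : M} (h : x = a * (x * y) * b) : GreenR (x * y) x := by
  refine Set.eq_of_subset_of_ncard_le ?_ ?_ (Set.toFinite _)
  · rintro _ ⟨m, rfl⟩
    exact ⟨y * m, by simp [mul_assoc]⟩
  · refine (Set.ncard_le_ncard (t := (a * ·) '' Set.range fun m => x * y * m) ?_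
      (Set.toFinite _)).trans (Set.ncard_image_le (Set.toFinite _))
    rintro _ ⟨m, rfl⟩
    refine ⟨_, ⟨b * m, rfl⟩, ?_⟩
    conv_rhs => rw [h]
    simp [mul_assoc]

theorem greenL_mul_of_eq {x y a b : M} (h : y = a * (x * y) * b) : GreenL (x * y) y := by
  refine Set.eq_of_subset_of_ncard_le ?_ ?_ (Set.toFinite _)
  · rintro _ ⟨m, rfl⟩
    exact ⟨m * x, by simp [mul_assoc]⟩
  · refine (Set.ncard_le_ncard (t := (· * b) '' Set.range fun m => m * (x * y)) ?_
      (Set.toFinite _)).trans (Set.ncard_image_le (Set.toFinite _))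
    rintro _ ⟨m, rfl⟩
    refine ⟨_, ⟨m * a, rfl⟩, ?_⟩
    conv_rhs => rw [h]
    simp [mul_assoc]

theorem greenR_mul_of_greenD {x y : M} (h : GreenD x (x * y)) : GreenR (x * y) x := by
  obtain ⟨a, b, hab⟩ := h.exists_eq_mul_mul
  exact greenR_mul_of_eq hab

theorem greenL_mul_of_greenD {x y : M} (h : GreenD y (x * y)) : GreenL (x * y) y := by
  obtain ⟨a, b, hab⟩ := h.exists_eq_mul_mul
  exact greenL_mul_of_eq hab

/-- In a finite monoid, `𝓙`-equivalent elements are `𝓓`-equivalent. -/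
theorem greenD_of_eq_mul_mul {x y a b c d : M} (h : x = a * y * b) (h' : y = c * x * d) :
    GreenD x y := by
  -- Stability applies twice, along `x`, `xd`, `cxd = y`.
  have h1 : GreenR (x * d) x := greenR_mul_of_eq (a := a * c) (b := b) <| by
    conv_lhs => rw [h, h']
    simp [mul_assoc]
  have h2 : GreenL (c * (x * d)) (x * d) := greenL_mul_of_eq (a := a) (b := b * d) <| by
    conv_lhs => rw [h, h']
    simp [mul_assoc]
  rw [← mul_assoc, ← h'] at h2
  exact (GreenD.symm ⟨x * d, h2, h1⟩)

end Green

/-! ### The action of the Schützenberger group on the base point -/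

section Schutzenberger

variable {M : Type*} [Monoid M] {γ : M}

/-- The image `γ r_m = γ m` of the base point under an element of the Schützenberger group. -/
def schutzenbergerOrbit (g : SchutzenbergerGroup (HClass γ)) : M :=
  (g.1.unop ⟨γ, rfl, rfl⟩ : HClass γ)

theorem schutzenbergerOrbit_mem (g : SchutzenbergerGroup (HClass γ)) :
    schutzenbergerOrbit g ∈ HClass γ :=
  (g.1.unop ⟨γ, rfl, rfl⟩ : HClass γ).2

/-- Right translations commute with left multiplication, so the group also acts on points through
left factors `u`. -/
theorem schutzenbergerOrbit_mul {g : SchutzenbergerGroup (HClass γ)} {u : M}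
    (hu : schutzenbergerOrbit g = u * γ) (g' : SchutzenbergerGroup (HClass γ)) :
    schutzenbergerOrbit (g * g') = u * schutzenbergerOrbit g' := by
  obtain ⟨_, ⟨m, rfl⟩⟩ := g
  obtain ⟨_, ⟨m', rfl⟩⟩ := g'
  change γ * (m : M) = u * γ at hu
  change γ * (m : M) * (m' : M) = u * (γ * (m' : M))
  rw [hu, mul_assoc]

theorem exists_schutzenbergerOrbit_eq_mul (g : SchutzenbergerGroup (HClass γ)) :
    ∃ u v, schutzenbergerOrbit g = u * γ ∧ v * schutzenbergerOrbit g = γ := by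
  obtain ⟨⟨v, hv⟩, ⟨u, hu⟩⟩ := (greenL_iff _ _).1 (schutzenbergerOrbit_mem g).1
  exact ⟨u, v, hu.symm, hv⟩

/-- Every element of the 𝓗-class is some `vγ`, so a right translation is determined by its value at
`γ`. -/
theorem schutzenbergerOrbit_injective :
    Function.Injective (schutzenbergerOrbit (γ := γ)) := by
  rintro ⟨_, ⟨m, rfl⟩⟩ ⟨_, ⟨m', rfl⟩⟩ h
  change γ * (m : M) = γ * (m' : M) at h
  apply Subtype.ext
  apply MulOpposite.unop_injective
  funext z
  obtain ⟨v, hv⟩ := ((greenL_iff _ _).1 z.2.1).2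
  apply Subtype.ext
  change (z : M) * (m : M) = (z : M) * (m' : M)
  rw [← hv, mul_assoc, h, mul_assoc]

/-- Green's lemma: if `γm` lies in the 𝓗-class of `γ`, then `m` carries that whole class into
itself. -/
theorem exists_schutzenbergerOrbit_eq {z : M} (hz : z ∈ HClass γ) :
    ∃ g : SchutzenbergerGroup (HClass γ), schutzenbergerOrbit g = z := by
  obtain ⟨⟨t, ht⟩, ⟨m, hm⟩⟩ := (greenR_iff _ _).1 hz.2
  have hRT : m ∈ RT (HClass γ) := by
    intro y hy
    obtain ⟨⟨w, hw⟩, ⟨v, hv⟩⟩ := (greenL_iff _ _).1 hy.1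
    have h1 : y * m = v * z := by rw [← hv, mul_assoc, hm]
    have h2 : w * (y * m) = z := by rw [← mul_assoc, hw, hm]
    have h3 : y * m * t = y := by rw [h1, mul_assoc, ht, hv]
    exact ⟨Eq.trans hz.1 ((greenL_iff _ _).2 ⟨⟨w, h2⟩, ⟨v, h1.symm⟩⟩),
      Eq.trans hy.2 ((greenR_iff _ _).2 ⟨⟨t, h3⟩, ⟨m, rfl⟩⟩)⟩
  exact ⟨⟨_, ⟨m, hRT⟩, rfl⟩, hm⟩

theorem schutzenbergerOrbit_one :
    schutzenbergerOrbit (1 : SchutzenbergerGroup (HClass γ)) = γ := rfl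

end Schutzenberger

/-! ### The Schützenberger representation of a `𝓓`-class -/

section Representation

variable {M : Type*} [Monoid M]

/-- Translations from the base point `γ` to the `𝓛`-classes contained in `D`, with inverses. -/
structure LSection (D : Set M) (γ : M) where
  fwd : LClassesIn D → M
  back : LClassesIn D → M
  mem : ∀ L, γ * fwd L ∈ L.1
  mul_back : ∀ L, γ * fwd L * back L = γ

theorem LClassesIn.eq_setOf {D : Set M} (L : LClassesIn D) {x : M} (hx : x ∈ L.1) :
    L.1 = {y | GreenL x y} := by
  obtain ⟨⟨z, hz⟩, -⟩ := L.2
  rw [hz] at hx ⊢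
  ext y
  exact ⟨fun h => Eq.trans (Eq.symm hx) h, fun h => Eq.trans hx h⟩

theorem RClassesIn.eq_setOf {D : Set M} (R : RClassesIn D) {x : M} (hx : x ∈ R.1) :
    R.1 = {y | GreenR x y} := by
  obtain ⟨⟨z, hz⟩, -⟩ := R.2
  rw [hz] at hx ⊢
  ext y
  exact ⟨fun h => Eq.trans (Eq.symm hx) h, fun h => Eq.trans hx h⟩

theorem LClassesIn.nonempty {D : Set M} (L : LClassesIn D) : ∃ x, x ∈ L.1 := by
  obtain ⟨⟨z, hz⟩, -⟩ := L.2
  exact ⟨z, by rw [hz]; exact Eq.refl _⟩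

theorem LClassesIn.ext_of_mem {D : Set M} {L L' : LClassesIn D} {x : M} (h : x ∈ L.1)
    (h' : x ∈ L'.1) : L = L' :=
  Subtype.ext ((L.eq_setOf h).trans (L'.eq_setOf h').symm)

theorem exists_mem_lClassesIn {D : Set M} {γ : M} (hD : D = {y | GreenD γ y}) {x : M}
    (hx : x ∈ D) : ∃ L : LClassesIn D, x ∈ L.1 := by
  subst hD
  exact ⟨⟨{y | GreenL x y}, ⟨x, rfl⟩, fun y hy => GreenD.trans hx (greenD_of_greenL hy)⟩,
    Eq.refl _⟩

theorem exists_mem_rClassesIn {D : Set M} {γ : M} (hD : D = {y | GreenD γ y}) {x : M}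
    (hx : x ∈ D) : ∃ R : RClassesIn D, x ∈ R.1 := by
  subst hD
  exact ⟨⟨{y | GreenR x y}, ⟨x, rfl⟩, fun y hy => GreenD.trans hx (greenD_of_greenR hy)⟩,
    Eq.refl _⟩

theorem LSection.nonempty {D : Set M} {γ : M} (hD : D = {y | GreenD γ y}) :
    Nonempty (LSection D γ) := by
  have h : ∀ L : LClassesIn D, ∃ r r', γ * r ∈ L.1 ∧ γ * r * r' = γ := by
    intro L
    obtain ⟨x, hx⟩ := L.nonempty
    have hxD : x ∈ {y | GreenD γ y} := hD ▸ L.2.2 hx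
    obtain ⟨z, hr, hl⟩ := greenD_iff_exists_greenR_greenL.1 hxD
    obtain ⟨⟨r', h1⟩, ⟨r, rfl⟩⟩ := (greenR_iff _ _).1 hr
    refine ⟨r, r', ?_, h1⟩
    rw [L.eq_setOf hx]
    exact Eq.symm hl
  choose r r' h1 h2 using h
  exact ⟨⟨r, r', h1, h2⟩⟩

/-! ### Coordinates on the 𝓡-class of the base point, and the matrices they give -/

variable {D : Set M} {γ : M} (σ : LSection D γ)

/-- The point of the `𝓡`-class of `γ` with coordinates `g` and `j`. -/
def LSection.point (g : SchutzenbergerGroup (HClass γ)) (j : LClassesIn D) : M :=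
  schutzenbergerOrbit g * σ.fwd j

theorem LSection.greenL_point (g : SchutzenbergerGroup (HClass γ)) (j : LClassesIn D) :
    GreenL (γ * σ.fwd j) (σ.point g j) :=
  greenL_mul_right (schutzenbergerOrbit_mem g).1 _

theorem LSection.point_mem (g : SchutzenbergerGroup (HClass γ)) (j : LClassesIn D) :
    σ.point g j ∈ j.1 := by
  rw [j.eq_setOf (σ.mem j)]
  exact σ.greenL_point g j

theorem LSection.point_mul_back (g : SchutzenbergerGroup (HClass γ)) (j : LClassesIn D) :
    σ.point g j * σ.back j = schutzenbergerOrbit g := by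
  obtain ⟨u, -, hu, -⟩ := exists_schutzenbergerOrbit_eq_mul g
  rw [LSection.point, hu, mul_assoc u, mul_assoc u, σ.mul_back]

theorem LSection.greenR_point (g : SchutzenbergerGroup (HClass γ)) (j : LClassesIn D) :
    GreenR γ (σ.point g j) :=
  Eq.trans (schutzenbergerOrbit_mem g).2
    ((greenR_iff _ _).2 ⟨⟨σ.back j, σ.point_mul_back g j⟩, ⟨σ.fwd j, rfl⟩⟩)

theorem LSection.point_injective {g g' : SchutzenbergerGroup (HClass γ)} {j j' : LClassesIn D}
    (h : σ.point g j = σ.point g' j') : j = j' ∧ g = g' := by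
  obtain rfl : j = j' := LClassesIn.ext_of_mem (σ.point_mem g j) (h ▸ σ.point_mem g' j')
  refine ⟨rfl, schutzenbergerOrbit_injective ?_⟩
  rw [← σ.point_mul_back g j, h, σ.point_mul_back]

/-- Translating `z` back along its 𝓛-class lands in the 𝓗-class of `γ`, which is the orbit of `γ`.
-/
theorem LSection.exists_point_eq (hD : D = {y | GreenD γ y}) {z : M} (hz : GreenR γ z) :
    ∃ g j, σ.point g j = z := by
  have hzD : z ∈ D := hD ▸ greenD_of_greenR hz
  obtain ⟨j, hj⟩ := exists_mem_lClassesIn hD hzD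
  have hl : GreenL (γ * σ.fwd j) z := by
    have := σ.mem j
    rw [j.eq_setOf hj] at this
    exact Eq.symm this
  obtain ⟨⟨v, hv⟩, ⟨u, hu⟩⟩ := (greenL_iff _ _).1 hl
  have h1 : z * σ.back j = u * γ := by
    rw [← hu, mul_assoc u, σ.mul_back]
  have h2 : z * σ.back j * σ.fwd j = z := by rw [h1, mul_assoc, hu]
  have h3 : v * (z * σ.back j) = γ := by rw [← mul_assoc, hv, σ.mul_back]
  obtain ⟨g, hg⟩ := exists_schutzenbergerOrbit_eq (γ := γ) (z := z * σ.back j)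
    ⟨(greenL_iff _ _).2 ⟨⟨v, h3⟩, ⟨u, h1.symm⟩⟩,
      Eq.trans hz ((greenR_iff _ _).2 ⟨⟨σ.fwd j, h2⟩, ⟨σ.back j, rfl⟩⟩)⟩
  exact ⟨g, j, by rw [LSection.point, hg, h2]⟩

/-- Left equivariance of the coordinates: `g` acts as left multiplication by some `u`, which `v`
undoes on `γM`. -/
theorem LSection.point_mul {g g' : SchutzenbergerGroup (HClass γ)} {j l : LClassesIn D} {m : M} :
    σ.point g j * m = σ.point (g * g') l ↔ γ * σ.fwd j * m = σ.point g' l := by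
  obtain ⟨u, v, hu, hv⟩ := exists_schutzenbergerOrbit_eq_mul g
  have hvu : v * (u * γ) = γ := by rw [← hu, hv]
  have h : ∀ x, u * γ * x = u * (γ * x) := fun x => mul_assoc _ _ _
  have cancel : ∀ x, v * (u * (γ * x)) = γ * x := fun x => by rw [← h, ← mul_assoc, hvu]
  obtain ⟨u', -, hu', -⟩ := exists_schutzenbergerOrbit_eq_mul g'
  obtain ⟨-, ⟨t, ht⟩⟩ := (greenR_iff _ _).1 (schutzenbergerOrbit_mem g').2
  have h2 : σ.point (g * g') l = u * σ.point g' l := by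
    rw [LSection.point, schutzenbergerOrbit_mul hu, mul_assoc, LSection.point]
  have h3 : σ.point g j * m = u * (γ * σ.fwd j * m) := by
    rw [LSection.point, hu]; simp only [mul_assoc]
  rw [h2, h3]
  refine ⟨fun e => ?_, fun e => by rw [e]⟩
  have e' := congrArg (v * ·) e
  simp only [mul_assoc, cancel] at e'
  rw [LSection.point, ← ht, mul_assoc γ, cancel] at e'
  rw [LSection.point, ← ht]
  simpa only [mul_assoc] using e'

open Classical in
/-- The matrix of `m` in the right Schützenberger representation. -/
noncomputable def LSection.matrix (k : Type*) [Semiring k] (m : M) :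
    Matrix (LClassesIn D) (LClassesIn D) (MonoidAlgebra k (SchutzenbergerGroup (HClass γ))) :=
  fun i j => if h : ∃ g, γ * σ.fwd i * m = σ.point g j then MonoidAlgebra.single h.choose 1 else 0

section

variable (k : Type*) [Semiring k] {σ}

theorem LSection.matrix_eq_single {m : M} {i j : LClassesIn D}
    {g : SchutzenbergerGroup (HClass γ)} (h : γ * σ.fwd i * m = σ.point g j) :
    σ.matrix k m i j = MonoidAlgebra.single g 1 := by
  have h' : ∃ g, γ * σ.fwd i * m = σ.point g j := ⟨g, h⟩
  rw [LSection.matrix, dif_pos h']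
  rw [(σ.point_injective (h.symm.trans h'.choose_spec)).2]

theorem LSection.matrix_eq_zero_of_ne {m : M} {i j j' : LClassesIn D}
    {g : SchutzenbergerGroup (HClass γ)} (h : γ * σ.fwd i * m = σ.point g j) (hj : j ≠ j') :
    σ.matrix k m i j' = 0 :=
  dif_neg fun ⟨_, h'⟩ => hj (σ.point_injective (h.symm.trans h')).1

theorem LSection.matrix_eq_zero {m : M} {i : LClassesIn D}
    (h : ¬ ∃ j g, γ * σ.fwd i * m = σ.point g j) (j : LClassesIn D) : σ.matrix k m i j = 0 :=
  dif_neg fun h' => h ⟨j, h'⟩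

open Classical in
theorem LSection.coeff_matrix (m : M) (i j : LClassesIn D)
    (g : SchutzenbergerGroup (HClass γ)) :
    (σ.matrix k m i j).coeff g = if γ * σ.fwd i * m = σ.point g j then 1 else 0 := by
  by_cases h : ∃ g, γ * σ.fwd i * m = σ.point g j
  · obtain ⟨g', h⟩ := h
    rw [LSection.matrix_eq_single k h, MonoidAlgebra.coeff_single, Finsupp.single_apply]
    by_cases hg : g' = g
    · rw [if_pos hg, if_pos (hg ▸ h)]
    · rw [if_neg hg, if_neg fun h' => hg (σ.point_injective (h.symm.trans h')).2]
  · rw [LSection.matrix, dif_neg h, if_neg fun h' => h ⟨g, h'⟩]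
    rfl

theorem LSection.matrix_one [DecidableEq (LClassesIn D)] : σ.matrix k 1 = 1 := by
  have h : ∀ i, γ * σ.fwd i * 1 = σ.point 1 i := fun i => by
    rw [LSection.point, schutzenbergerOrbit_one, mul_one]
  ext1 i j
  by_cases hij : i = j
  · subst hij
    rw [LSection.matrix_eq_single k (h i), Matrix.one_apply_eq, MonoidAlgebra.one_def]
  · rw [LSection.matrix_eq_zero_of_ne k (h i) hij, Matrix.one_apply_ne hij]

theorem LSection.matrix_mul [Fintype (LClassesIn D)] (hD : D = {y | GreenD γ y}) (m n : M) :
    σ.matrix k (m * n) = σ.matrix k m * σ.matrix k n := by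
  ext1 i l
  rw [Matrix.mul_apply]
  by_cases h : ∃ j g, γ * σ.fwd i * m = σ.point g j
  · obtain ⟨j, g, h⟩ := h
    rw [Finset.sum_eq_single j (fun j' _ hj' => by
      rw [LSection.matrix_eq_zero_of_ne k h hj'.symm, zero_mul]) (by simp),
      LSection.matrix_eq_single k h]
    by_cases h' : ∃ g', γ * σ.fwd j * n = σ.point g' l
    · obtain ⟨g', h'⟩ := h'
      rw [LSection.matrix_eq_single k h', MonoidAlgebra.single_mul_single, mul_one]
      exact LSection.matrix_eq_single k (by rw [← mul_assoc, h, σ.point_mul, h'])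
    · rw [LSection.matrix, dif_neg, LSection.matrix, dif_neg h', mul_zero]
      rintro ⟨g', e⟩
      rw [← mul_assoc, h] at e
      -- Dividing by `g` would give a nonzero entry of the matrix of `n` at `(j, l)`.
      obtain ⟨c, hc⟩ := isUnit_schutzenbergerGroup γ g
      refine h' ⟨↑c⁻¹ * g', ?_⟩
      rwa [← σ.point_mul (g := g), ← mul_assoc, ← hc, Units.mul_inv, one_mul, hc]
  · have h0 : ¬ ∃ j g, γ * σ.fwd i * (m * n) = σ.point g j := by
      rintro ⟨j, g, e⟩
      refine h ?_
      obtain ⟨⟨t, ht⟩, -⟩ := (greenR_iff _ _).1 (σ.greenR_point g j)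
      obtain ⟨g', j', h'⟩ := σ.exists_point_eq hD (z := γ * σ.fwd i * m)
        ((greenR_iff _ _).2 ⟨⟨n * t, by
          refine Eq.trans ?_ ((congrArg (· * t) e).trans ht)
          simp only [mul_assoc]⟩,
          ⟨σ.fwd i * m, by rw [mul_assoc]⟩⟩)
      exact ⟨j', g', h'.symm⟩
    rw [LSection.matrix_eq_zero k h0]
    exact (Finset.sum_eq_zero fun j _ => by rw [LSection.matrix_eq_zero k h, zero_mul]).symm

/-- The right Schützenberger representation of a `𝓓`-class. -/
noncomputable def LSection.representation [Fintype (LClassesIn D)] [DecidableEq (LClassesIn D)]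
    (σ : LSection D γ) (hD : D = {y | GreenD γ y}) :
    M →* Matrix (LClassesIn D) (LClassesIn D)
      (MonoidAlgebra k (SchutzenbergerGroup (HClass γ))) where
  toFun := σ.matrix k
  map_one' := LSection.matrix_one k
  map_mul' := LSection.matrix_mul k hD

end

/-! ### Coordinates on a `𝓓`-class with the bijection condition -/

variable {σ}

/-- The source of triangularity: a nonzero entry forces `γ ∈ MmM`. -/
theorem eq_mul_mul_of_eq_point {m : M} {i j : LClassesIn D}
    {g : SchutzenbergerGroup (HClass γ)} (h : γ * σ.fwd i * m = σ.point g j) :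
    ∃ a b, γ = a * m * b := by
  obtain ⟨⟨t, ht⟩, -⟩ := (greenR_iff _ _).1 (σ.greenR_point g j)
  exact ⟨γ * σ.fwd i, t, by rw [h, ht]⟩

theorem matched_of_eq_point {m : M} {i j : LClassesIn D}
    {g : SchutzenbergerGroup (HClass γ)} (h : γ * σ.fwd i * m = σ.point g j) {R : RClassesIn D}
    (hR : m ∈ R.1) : Matched D i.1 R.1 :=
  ⟨_, σ.mem i, m, hR, by rw [h]; exact j.2.2 (σ.point_mem g j)⟩

/-- The 𝓡-class of `m` is `F i` for some `i`. Being matched does not depend on representatives, so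
`γ r_i m ∈ D`, and stability puts it in the 𝓡-class of `γ`. -/
theorem exists_eq_point [Finite M] (hD : D = {y | GreenD γ y}) (hF : BijectionCondition D) {m : M} (hm : m ∈ D) :
    ∃ i j g, γ * σ.fwd i * m = σ.point g j := by
  obtain ⟨F, hF, -⟩ := hF
  obtain ⟨R, hR⟩ := exists_mem_rClassesIn hD hm
  obtain ⟨i, rfl⟩ := F.surjective R
  obtain ⟨x, hx, y, hy, hxy⟩ := hF i
  have hl : GreenL x (γ * σ.fwd i) := by
    have := σ.mem i
    rwa [i.eq_setOf hx] at this
  have hr : GreenR y m := by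
    rwa [RClassesIn.eq_setOf _ hy] at hR
  have h1 : GreenD γ (γ * σ.fwd i * m) := by
    rw [hD] at hxy
    exact (GreenD.trans hxy (greenD_of_greenL (greenL_mul_right hl y))).trans
      (greenD_of_greenR (greenR_mul_left hr _))
  rw [mul_assoc] at h1
  obtain ⟨g, j, h⟩ := σ.exists_point_eq hD (Eq.symm (greenR_mul_of_greenD h1))
  exact ⟨i, j, g, by rw [h, mul_assoc]⟩

/-- Both elements lie in `F i`, since other 𝓡-classes are unmatched with `i`; so `n = mt`. By
stability `m = v(γ r_i m)`, and applying `v` to the common value gives `m = mt`. -/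
theorem eq_of_eq_point [Finite M] (hD : D = {y | GreenD γ y}) (hF : BijectionCondition D) {m n : M} (hm : m ∈ D) (hn : n ∈ D)
    {i j : LClassesIn D} {g : SchutzenbergerGroup (HClass γ)}
    (h : γ * σ.fwd i * m = σ.point g j) (h' : γ * σ.fwd i * n = σ.point g j) : m = n := by
  obtain ⟨F, -, hF⟩ := hF
  obtain ⟨R, hR⟩ := exists_mem_rClassesIn hD hm
  obtain ⟨R', hR'⟩ := exists_mem_rClassesIn hD hn
  obtain rfl : R = F i := by_contra fun hne => hF i R hne (matched_of_eq_point h hR)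
  obtain rfl : R' = F i := by_contra fun hne => hF i R' hne (matched_of_eq_point h' hR')
  rw [RClassesIn.eq_setOf _ hR] at hR'
  obtain ⟨-, ⟨t, rfl⟩⟩ := (greenR_iff _ _).1 hR'
  have hmD : GreenD γ m := by rwa [hD] at hm
  have hl : GreenL (γ * σ.fwd i * m) m := greenL_mul_of_greenD <| hmD.symm.trans <| by
    rw [h]; exact greenD_of_greenR (σ.greenR_point g j)
  obtain ⟨-, ⟨v, hv⟩⟩ := (greenL_iff _ _).1 hl
  calc m = v * (γ * σ.fwd i * m) := hv.symm
    _ = v * (γ * σ.fwd i * (m * t)) := by rw [h, h']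
    _ = v * (γ * σ.fwd i * m) * t := by simp only [mul_assoc]
    _ = m * t := by rw [hv]

/-- For a suitable `y ∈ F i`, `γ r_i y` is in the 𝓡-class of `γ`, so some `t` moves it to the
prescribed point. The element `yt` stays in `D` because that point lies in `MytM`. -/
theorem exists_mem_eq_point [Finite M] (hD : D = {y | GreenD γ y}) (hF : BijectionCondition D) (i j : LClassesIn D)
    (g : SchutzenbergerGroup (HClass γ)) : ∃ m ∈ D, γ * σ.fwd i * m = σ.point g j := by
  obtain ⟨F, hF, -⟩ := hF
  obtain ⟨x, hx, y, hy, hxy⟩ := hF i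
  have hl : GreenL x (γ * σ.fwd i) := by
    have := σ.mem i
    rwa [i.eq_setOf hx] at this
  have hyD : GreenD γ y := by
    have := (F i).2.2 hy
    rwa [hD] at this
  have h1 : GreenD γ (γ * σ.fwd i * y) := by
    rw [hD] at hxy
    exact GreenD.trans hxy (greenD_of_greenL (greenL_mul_right hl y))
  rw [mul_assoc] at h1
  have h2 : GreenR (γ * σ.fwd i * y) (σ.point g j) := by
    rw [mul_assoc]
    exact Eq.trans (greenR_mul_of_greenD h1) (σ.greenR_point g j)
  obtain ⟨-, ⟨t, ht⟩⟩ := (greenR_iff _ _).1 h2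
  have h3 : GreenD y (y * t) := by
    obtain ⟨a, b, hab⟩ := (hyD.symm.trans (greenD_of_greenR (σ.greenR_point g j))).exists_eq_mul_mul
    refine greenD_of_eq_mul_mul (a := a * (γ * σ.fwd i)) (b := b) (c := 1) (d := t) ?_ (by simp)
    calc y = a * σ.point g j * b := hab
      _ = _ := by rw [← ht]; simp only [mul_assoc]
  exact ⟨y * t, by rw [hD]; exact hyD.trans h3, by rw [← mul_assoc, ht]⟩

theorem left_index_unique (hD : D = {y | GreenD γ y}) (hF : BijectionCondition D) {m : M} (hm : m ∈ D)
    {i i' j j' : LClassesIn D} {g g' : SchutzenbergerGroup (HClass γ)}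
    (h : γ * σ.fwd i * m = σ.point g j) (h' : γ * σ.fwd i' * m = σ.point g' j') : i = i' := by
  obtain ⟨F, -, hF⟩ := hF
  obtain ⟨R, hR⟩ := exists_mem_rClassesIn hD hm
  apply F.injective
  rw [← by_contra fun hne => hF i R hne (matched_of_eq_point h hR),
    ← by_contra fun hne => hF i' R hne (matched_of_eq_point h' hR)]

end Representation

/-! ### Constructions of cell algebras -/

section CellAlgebra

variable {k : Type*} [Field k]

theorem IsCellAlgebra.of_algEquiv {A B : Type*} [Ring A] [Algebra k A] [Ring B] [Algebra k B]
    (e : A ≃ₐ[k] B) (h : IsCellAlgebra k A) : IsCellAlgebra k B := by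
  obtain ⟨⟨Λ, Lft, Rgt, C, hl, hr⟩⟩ := h
  have hspan : ∀ (l : Λ) (x : A),
      x ∈ Submodule.span k {x : A | ∃ (l' : Λ) (p : Lft l' × Rgt l'), l < l' ∧ x = C ⟨l', p⟩} →
      e x ∈ Submodule.span k {x : B | ∃ (l' : Λ) (p : Lft l' × Rgt l'),
        l < l' ∧ x = C.map e.toLinearEquiv ⟨l', p⟩} := by
    intro l x hx
    have := Submodule.mem_map_of_mem (f := e.toLinearMap) hx
    rw [Submodule.map_span] at this
    refine Submodule.span_mono ?_ this
    rintro _ ⟨_, ⟨l', p, hlt, rfl⟩, rfl⟩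
    exact ⟨l', p, hlt, by simp⟩
  refine ⟨⟨Λ, Lft, Rgt, C.map e.toLinearEquiv, fun a l s => ?_, fun a l t => ?_⟩⟩
  · obtain ⟨r, h⟩ := hl (e.symm a) l s
    exact ⟨r, fun t => by simpa using hspan l _ (h t)⟩
  · obtain ⟨r, h⟩ := hr (e.symm a) l t
    exact ⟨r, fun s => by simpa using hspan l _ (h s)⟩

/-- The poset is unchanged; matrix rows join the left indices and columns the right ones, with basis
the cell basis placed in single entries. -/
theorem IsCellAlgebra.matrix {A : Type*} [Ring A] [Algebra k A] (h : IsCellAlgebra k A)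
    (n : Type*) [Fintype n] [DecidableEq n] : IsCellAlgebra k (Matrix n n A) := by
  obtain ⟨⟨Λ, Lft, Rgt, C, hl, hr⟩⟩ := h
  let E : (n × n × Σ l : Λ, Lft l × Rgt l) ≃ Σ l : Λ, (n × Lft l) × (n × Rgt l) :=
    { toFun := fun x => ⟨x.2.2.1, (x.1, x.2.2.2.1), (x.2.1, x.2.2.2.2)⟩
      invFun := fun x => (x.2.1.1, x.2.2.1, ⟨x.1, x.2.1.2, x.2.2.2⟩)
      left_inv := fun _ => rfl
      right_inv := fun _ => rfl }
  let B := (C.matrix n n).reindex E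
  have hB : ∀ l i s j t, B ⟨l, (i, s), (j, t)⟩ = Matrix.single i j (C ⟨l, s, t⟩) := by
    intro l i s j t
    simp only [B, Module.Basis.reindex_apply]
    exact Module.Basis.matrix_apply C i j ⟨l, s, t⟩
  have hspan : ∀ (l : Λ) (i j : n) (x : A),
      x ∈ Submodule.span k {x : A | ∃ (l' : Λ) (p : Lft l' × Rgt l'), l < l' ∧ x = C ⟨l', p⟩} →
      Matrix.single i j x ∈ Submodule.span k {x : Matrix n n A |
        ∃ (l' : Λ) (p : (n × Lft l') × (n × Rgt l')), l < l' ∧ x = B ⟨l', p⟩} := by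
    intro l i j x hx
    have := Submodule.mem_map_of_mem (f := Matrix.singleLinearMap k i j) hx
    rw [Submodule.map_span] at this
    refine Submodule.span_mono ?_ this
    rintro _ ⟨_, ⟨l', p, hlt, rfl⟩, rfl⟩
    exact ⟨l', ((i, p.1), (j, p.2)), hlt, by simp [hB]⟩
  refine (CellStructure.mk (R := k) Λ (fun l => n × Lft l) (fun l => n × Rgt l) B ?_ ?_).isCellAlgebra
  · rintro a l ⟨i, s⟩
    choose r h using fun p => hl (a p i) l s
    refine ⟨fun q => r q.1 q.2, ?_⟩
    rintro ⟨j, t⟩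
    -- The error lives in column `j`, and its entry in row `p` is the error in `A` for the
    -- coefficient `a p i`.
    have key : a * B ⟨l, (i, s), (j, t)⟩ - ∑ q : n × Lft l, r q.1 q.2 • B ⟨l, q, (j, t)⟩ =
        ∑ p, Matrix.single p j (a p i * C ⟨l, s, t⟩ - ∑ s', r p s' • C ⟨l, s', t⟩) := by
      rw [Fintype.sum_prod_type]
      simp only [hB, Matrix.smul_single]
      ext p q
      by_cases hq : j = q <;>
        simp [Matrix.sum_apply, Matrix.single_apply, Matrix.mul_apply, hq]
    rw [key]
    exact Submodule.sum_mem _ fun p _ => hspan l p j _ (h p t)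
  · rintro a l ⟨j, t⟩
    choose r h using fun p => hr (a j p) l t
    refine ⟨fun q => r q.1 q.2, ?_⟩
    rintro ⟨i, s⟩
    have key : B ⟨l, (i, s), (j, t)⟩ * a - ∑ q : n × Rgt l, r q.1 q.2 • B ⟨l, (i, s), q⟩ =
        ∑ p, Matrix.single i p (C ⟨l, s, t⟩ * a j p - ∑ t', r p t' • C ⟨l, s, t'⟩) := by
      rw [Fintype.sum_prod_type]
      simp only [hB, Matrix.smul_single]
      ext p q
      by_cases hq : i = p <;>
        simp [Matrix.sum_apply, Matrix.single_apply, Matrix.mul_apply, hq]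
    rw [key]
    exact Submodule.sum_mem _ fun p _ => hspan l i p _ (h p s)

/-- The poset is the disjoint union, with different factors incomparable. -/
theorem IsCellAlgebra.pi {ι : Type*} [Finite ι] {A : ι → Type*} [∀ i, Ring (A i)]
    [∀ i, Algebra k (A i)] (h : ∀ i, IsCellAlgebra k (A i)) : IsCellAlgebra k (∀ i, A i) := by
  classical
  have := Fintype.ofFinite ι
  let S := fun i => (h i).some
  let _ := fun i => (S i).order
  have := fun i => (S i).finite
  let _ := fun i => (S i).fintypeLft
  let _ := fun i => (S i).fintypeRgt
  let B := (Pi.basis fun i => (S i).C).reindex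
    (Equiv.sigmaAssoc fun i (l : (S i).Λ) => (S i).Lft l × (S i).Rgt l).symm
  have hB : ∀ i l p, B ⟨⟨i, l⟩, p⟩ = Pi.single i ((S i).C ⟨l, p⟩) := by
    intro i l p
    simp only [B, Module.Basis.reindex_apply]
    exact Pi.basis_apply _ _
  have hspan : ∀ (i : ι) (l : (S i).Λ) (x : A i),
      x ∈ Submodule.span k {x : A i | ∃ (l' : (S i).Λ) (p : (S i).Lft l' × (S i).Rgt l'),
        l < l' ∧ x = (S i).C ⟨l', p⟩} →
      Pi.single i x ∈ Submodule.span k {x : ∀ i, A i | ∃ (l' : Σ i, (S i).Λ)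
        (p : (S l'.1).Lft l'.2 × (S l'.1).Rgt l'.2), ⟨i, l⟩ < l' ∧ x = B ⟨l', p⟩} := by
    intro i l x hx
    have := Submodule.mem_map_of_mem (f := LinearMap.single k A i) hx
    rw [Submodule.map_span] at this
    refine Submodule.span_mono ?_ this
    rintro _ ⟨_, ⟨l', p, hlt, rfl⟩, rfl⟩
    exact ⟨⟨i, l'⟩, p, Sigma.mk_lt_mk_iff.2 hlt, by simp [hB]⟩
  refine (CellStructure.mk (R := k) (Σ i, (S i).Λ) (fun l => (S l.1).Lft l.2)
    (fun l => (S l.1).Rgt l.2) B ?_ ?_).isCellAlgebra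
  · rintro a ⟨i, l⟩ s
    obtain ⟨r, h⟩ := (S i).mul_left (a i) l s
    refine ⟨r, fun t => ?_⟩
    convert hspan i l _ (h t) using 1
    simp only [hB]
    ext j
    by_cases hj : j = i
    · subst hj; simp
    · simp [hj]
  · rintro a ⟨i, l⟩ t
    obtain ⟨r, h⟩ := (S i).mul_right (a i) l t
    refine ⟨r, fun s => ?_⟩
    convert hspan i l _ (h s) using 1
    simp only [hB]
    ext j
    by_cases hj : j = i
    · subst hj; simp
    · simp [hj]

end CellAlgebra

/-! ### The decomposition of the monoid algebra -/

section Decomposition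

variable {M : Type*} [Monoid M]

instance DClass.instFinite [Finite M] : Finite (DClass M) := by
  unfold DClass
  infer_instance

instance LClassesIn.instFinite [Finite M] (D : Set M) : Finite (LClassesIn D) := by
  unfold LClassesIn
  infer_instance

instance SchutzenbergerGroup.instFinite [Finite M] (H : Set M) :
    Finite (SchutzenbergerGroup H) :=
  Finite.of_surjective (rightTranslation H).mrangeRestrict
    (rightTranslation H).mrangeRestrict_surjective

theorem DClass.ext_of_mem {D D' : DClass M} {x : M} (h : x ∈ D.1) (h' : x ∈ D'.1) : D = D' :=
  Subtype.ext ((D.eq_setOf h).trans (D'.eq_setOf h').symm)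

variable (k : Type*) [Field k]
  {γ : ∀ D : DClass M, D.1} (σ : ∀ D : DClass M, LSection D.1 (γ D : M))
  [∀ D : DClass M, Fintype (LClassesIn D.1)] [∀ D : DClass M, DecidableEq (LClassesIn D.1)]

/-- The product of the right Schützenberger representations of all `𝓓`-classes. -/
noncomputable def schutzenbergerAlgHom :
    MonoidAlgebra k M →ₐ[k] ∀ D : DClass M, Matrix (LClassesIn D.1) (LClassesIn D.1)
      (MonoidAlgebra k (SchutzenbergerGroup (HClass (γ D : M)))) :=
  AlgHom.pi fun D => MonoidAlgebra.lift k _ M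
    ((σ D).representation k (D.eq_setOf (γ D).2))

theorem coeff_schutzenbergerAlgHom (x : MonoidAlgebra k M) (D : DClass M) (i j : LClassesIn D.1)
    (g : SchutzenbergerGroup (HClass (γ D : M))) :
    (schutzenbergerAlgHom k σ x D i j).coeff g =
      x.coeff.sum fun m c => c * ((σ D).matrix k m i j).coeff g := by
  change ((MonoidAlgebra.lift k _ M ((σ D).representation k (D.eq_setOf (γ D).2)) x) i j).coeff g
    = _
  rw [MonoidAlgebra.lift_apply, Finsupp.sum, Matrix.sum_apply, MonoidAlgebra.coeff_sum,
    Finsupp.finsetSum_apply]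
  rfl

variable [Finite M]

theorem schutzenbergerAlgHom_injective (hF : ∀ D : DClass M, BijectionCondition D.1) :
    Function.Injective (schutzenbergerAlgHom k σ) := by
  classical
  rw [injective_iff_map_eq_zero]
  intro x hx
  by_contra hne
  -- Choose `m` in the support with `MmM` of largest size; one matrix coefficient of the image will
  -- then see `m` alone.
  obtain ⟨m, hm, hmax⟩ := Finset.exists_max_image x.coeff.support
    (fun m => (Set.range fun p : M × M => p.1 * m * p.2).ncard)
    (Finsupp.support_nonempty_iff.2 fun h => hne (MonoidAlgebra.coeff_eq_zero.1 h))
  let D : DClass M := ⟨{y | GreenD m y}, m, rfl⟩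
  have hmD : m ∈ D.1 := greenD_of_greenL rfl
  have hD := D.eq_setOf (γ D).2
  obtain ⟨i, j, g, h⟩ := exists_eq_point (σ := σ D) hD (hF D) hmD
  have hsum := coeff_schutzenbergerAlgHom k σ x D i j g
  have hzero : (schutzenbergerAlgHom k σ x D i j).coeff g = 0 := by rw [hx]; rfl
  rw [hzero, Finsupp.sum, Finset.sum_eq_single m, LSection.coeff_matrix, if_pos h, mul_one] at hsum
  · exact Finsupp.mem_support_iff.1 hm hsum.symm
  · intro n hn hnm
    rw [LSection.coeff_matrix, if_neg, mul_zero]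
    intro h'
    refine hnm (eq_of_eq_point hD (hF D) ?_ hmD h' h)
    -- Any other `n` contributing there has `MmM ⊆ MnM`; maximality gives equality, so `n ∈ D`, and
    -- its coordinates force `n = m`.
    obtain ⟨a, b, hab⟩ := eq_mul_mul_of_eq_point h'
    obtain ⟨c, d, hcd⟩ := GreenD.exists_eq_mul_mul (x := m) (y := (γ D : M)) (γ D).2
    have hmn : m = c * a * n * (b * d) := by
      rw [hcd, hab]
      simp only [mul_assoc]
    have hsub : (Set.range fun p : M × M => p.1 * m * p.2) ⊆
        Set.range fun p : M × M => p.1 * n * p.2 := by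
      rintro _ ⟨p, rfl⟩
      refine ⟨(p.1 * (c * a), b * d * p.2), ?_⟩
      conv_rhs => rw [hmn]
      simp only [mul_assoc]
    have hn' : n ∈ Set.range fun p : M × M => p.1 * m * p.2 := by
      rw [Set.eq_of_subset_of_ncard_le hsub (hmax n hn) (Set.toFinite _)]
      exact ⟨(1, 1), by simp⟩
    obtain ⟨p, hp⟩ := hn'
    exact greenD_of_eq_mul_mul hmn hp.symm
  · intro h'
    exact absurd hm h'

theorem schutzenbergerAlgHom_bijective (hF : ∀ D : DClass M, BijectionCondition D.1) :
    Function.Bijective (schutzenbergerAlgHom k σ) := by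
  classical
  have hinj := schutzenbergerAlgHom_injective k σ hF
  refine ⟨hinj, ?_⟩
  have := Fintype.ofFinite M
  have := Fintype.ofFinite (DClass M)
  have := fun D : DClass M => Fintype.ofFinite (SchutzenbergerGroup (HClass (γ D : M)))
  let B := Pi.basis fun D : DClass M =>
    (MonoidAlgebra.basis (SchutzenbergerGroup (HClass (γ D : M))) k).matrix
      (LClassesIn D.1) (LClassesIn D.1)
  -- The triples `(i, j, g)` over all `D` index a basis of the target; embedding them in `M` bounds
  -- its dimension by that of `k[M]`.
  choose f hfD hf using fun p : Σ D : DClass M, LClassesIn D.1 × LClassesIn D.1 ×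
      SchutzenbergerGroup (HClass (γ D : M)) =>
    exists_mem_eq_point (σ := σ p.1) (p.1.eq_setOf (γ p.1).2) (hF p.1) p.2.1 p.2.2.1 p.2.2.2
  have hfinj : Function.Injective f := by
    rintro ⟨D, i, j, g⟩ ⟨D', i', j', g'⟩ h
    have hp := hfD ⟨D, i, j, g⟩
    have hp' := hfD ⟨D', i', j', g'⟩
    have e := hf ⟨D, i, j, g⟩
    have e' := hf ⟨D', i', j', g'⟩
    rw [← h] at hp' e'
    obtain rfl : D = D' := DClass.ext_of_mem hp hp'
    obtain rfl : i = i' := left_index_unique (D.eq_setOf (γ D).2) (hF D) hp e e'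
    obtain ⟨rfl, rfl⟩ := (σ D).point_injective (e.symm.trans e')
    rfl
  have := Module.Basis.finiteDimensional_of_finite (MonoidAlgebra.basis M k)
  have := Module.Basis.finiteDimensional_of_finite B
  refine (LinearMap.injective_iff_surjective_of_finrank_eq_finrank
    (f := (schutzenbergerAlgHom k σ).toLinearMap) (le_antisymm ?_ ?_)).1 hinj
  · exact LinearMap.finrank_le_finrank_of_injective
      (f := (schutzenbergerAlgHom k σ).toLinearMap) hinj
  · rw [Module.finrank_eq_card_basis B, Module.finrank_eq_card_basis (MonoidAlgebra.basis M k)]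
    exact Fintype.card_le_of_injective f hfinj

end Decomposition

theorem proposition4p4 (k : Type*) [Field k] (M : Type*) [Monoid M] [Finite M]
    (γ : ∀ D : DClass M, D.1)
    (hG : ∀ D : DClass M,
      IsCellAlgebra k (MonoidAlgebra k (SchutzenbergerGroup (HClass (γ D : M)))) ∧
      IsSemisimpleRing (MonoidAlgebra k (SchutzenbergerGroup (HClass (γ D : M)))))
    (hF : ∀ D : DClass M, BijectionCondition D.1) :
    IsCellAlgebra k (MonoidAlgebra k M) ∧ IsSemisimpleRing (MonoidAlgebra k M) := by
  classical
  have := fun D : DClass M => Fintype.ofFinite (LClassesIn D.1)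
  -- Makes semisimplicity of the matrix rings and of their finite product available by instance
  -- search.
  have := fun D => (hG D).2
  let σ := fun D : DClass M => (LSection.nonempty (D.eq_setOf (γ D).2)).some
  let e := (AlgEquiv.ofBijective _ (schutzenbergerAlgHom_bijective k σ hF)).symm
  exact ⟨.of_algEquiv e (.pi fun D => (hG D).1.matrix _), e.toRingEquiv.isSemisimpleRing⟩
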